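/- Let $A$ and $B$ be $C^*$-algebras. For a Hilbert $B$-module $E$ (right module, inner product linear in the second variable), $\mathcal{L}(E)$ denotes the $C^*$-algebra of adjointable operators on $E$. A completely positive map $\varphi:A\to\mathcal{L}(E)$ is *strict* if there is an approximate unit $(a_\lambda)$ of $A$ such that $(\varphi(a_\lambda))$ is Cauchy in the strict topology, i.e. $(\varphi(a_\lambda)x)$ and $(\varphi(a_\lambda)^*x)$ are Cauchy for every $x\in E$. Let $\mathrm{PosCor}(A,B)$ be the category whose objects are pairs $(E,\varphi)$ of a Hilbert $B$-module $E$ and a strict completely positive map $\varphi:A\to\mathcal{L}(E)$, and whose morphisms $(E_1,\varphi_1)\to(E_2,\varphi_2)$ are pairs $(\eta,\alpha)$ of an adjointable operator $\eta\in\mathcal{L}(E_1,E_2)$ and a $*$-automorphism $\alpha$ of $A$ with $\varphi_2(\alpha(a))\,\eta=\eta\,\varphi_1(a)$ for all $a\in A$; composition is $(\xi,\beta)\circ(\eta,\alpha)=(\xi\eta,\beta\alpha)$ and the identity is $(1_E,1_A)$. For an object $(E,\varphi)$ let $F_\varphi=A\otimes_\varphi E$ be the Hilbert $B$-module obtained from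 the algebraic tensor product $A\otimes_{\mathrm{alg}}E$ with the $B$-valued form $\langle a\otimes x,b\otimes y\rangle=\langle x,\varphi(a^*b)y\rangle$ by dividing out the null vectors and completing; write $a\,\dot\otimes\,x$ for the class of $a\otimes x$. Let $\pi_\varphi:A\to\mathcal{L}(F_\varphi)$ be the $*$-homomorphism $\pi_\varphi(a)(b\,\dot\otimes\,x)=ab\,\dot\otimes\,x$, which is strict, and let $V_\varphi:E\to F_\varphi$ be the bounded operator $V_\varphi x=\lim_\lambda a_\lambda\,\dot\otimes\,x$, where $(a_\lambda)$ is an approximate unit as in the definition of strictness. Let $\mathrm{KSGNS}:\mathrm{PosCor}(A,B)\to\mathrm{PosCor}(A,B)$ be the functor $$(E,\varphi)\mapsto(F_\varphi,\pi_\varphi),\qquad(\eta,\alpha)\mapsto(\tilde\eta,\alpha),\qquad\tilde\eta(a\,\dot\otimes\,x)=\alpha(a)\,\dot\otimes\,\eta(x).$$ **Proposition.** The functors $\mathrm{KSGNS}$ and $\mathrm{KSGNS}\circ\mathrm{KSGNS}$ are naturally isomorphic. More precisely, there is a natural isomorphism $\mathrm{KSGNS}\Rightarrow\mathrm{KSGNS}\circ\mathrm{KSGNS}$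 whose component at each object $(E,\varphi)$ is $(V_{\pi_\varphi},1_A):(F_\varphi,\pi_\varphi)\to(F_{\pi_\varphi},\pi_{\pi_\varphi})$. Moreover, $V_{\pi_\varphi}:F_\varphi\to F_{\pi_\varphi}$ is a unitary with $\pi_{\pi_\varphi}(a)=V_{\pi_\varphi}\,\pi_\varphi(a)\,V_{\pi_\varphi}^*$ for all $a\in A$. -/

import Mathlib

open scoped TensorProduct CStarAlgebra
open CategoryTheory Filter Topology UniformSpace

universe u v w w₁ w₂ w₃

noncomputable section

set_option linter.unusedSectionVars false

/-! ### Adjointable operators between Hilbert modules -/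

namespace HilbertModule

section Adjointable

variable (C : Type v) [NonUnitalCStarAlgebra C] [PartialOrder C] [StarOrderedRing C]
variable {E : Type w₁} [NormedAddCommGroup E] [NormedSpace ℂ E] [SMul C E] [CStarModule C E]
variable {F : Type w₂} [NormedAddCommGroup F] [NormedSpace ℂ F] [SMul C F] [CStarModule C F]
variable {G : Type w₃} [NormedAddCommGroup G] [NormedSpace ℂ G] [SMul C G] [CStarModule C G]

/-- `S` is an adjoint of `T` for the `C`-valued inner products: `⟨T x, y⟩ = ⟨x, S y⟩`. -/
def IsAdjointPair (T : E →L[ℂ] F) (S : F →L[ℂ] E) : Prop :=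
  ∀ x y, inner C (T x) y = inner C x (S y)

/-- `T` is adjointable, i.e. `T ∈ ℒ(E, F)`. -/
def IsAdjointable (T : E →L[ℂ] F) : Prop := ∃ S : F →L[ℂ] E, IsAdjointPair C T S

variable {C}

theorem ext_inner {x y : E} (h : ∀ z : E, inner C z x = inner C z y) : x = y := by
  have : inner C (x - y) (x - y) = 0 := by
    rw [CStarModule.inner_sub_right, h, sub_self]
  exact sub_eq_zero.mp (CStarModule.inner_self.mp this)

theorem IsAdjointPair.symm {T : E →L[ℂ] F} {S : F →L[ℂ] E} (h : IsAdjointPair C T S) :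
    IsAdjointPair C S T := fun x y => by
  rw [← CStarModule.star_inner y (S x), ← h, CStarModule.star_inner]

theorem IsAdjointPair.unique {T : E →L[ℂ] F} {S S' : F →L[ℂ] E} (h : IsAdjointPair C T S)
    (h' : IsAdjointPair C T S') : S = S' := by
  ext y
  exact ext_inner (C := C) fun z => by rw [← h, ← h']

theorem IsAdjointPair.comp {T : E →L[ℂ] F} {S : F →L[ℂ] E} {T' : F →L[ℂ] G} {S' : G →L[ℂ] F}
    (h : IsAdjointPair C T S) (h' : IsAdjointPair C T' S') :
    IsAdjointPair C (T' ∘L T) (S ∘L S') := fun x y => by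
  simp only [ContinuousLinearMap.comp_apply]
  rw [h', h]

theorem IsAdjointPair.id : IsAdjointPair C (.id ℂ E) (.id ℂ E) := fun _ _ => rfl

theorem IsAdjointPair.norm_sq_le {T : E →L[ℂ] F} {S : F →L[ℂ] E} (h : IsAdjointPair C T S)
    (x : E) : ‖T x‖ ^ 2 ≤ ‖(S ∘L T) x‖ * ‖x‖ := by
  rw [CStarModule.norm_sq_eq C, h, mul_comm]
  exact CStarModule.norm_inner_le E

theorem IsAdjointPair.norm_le {T : E →L[ℂ] F} {S : F →L[ℂ] E} (h : IsAdjointPair C T S) :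
    ‖T‖ ≤ ‖S‖ := by
  refine T.opNorm_le_bound (norm_nonneg _) fun x => ?_
  have h1 := h.norm_sq_le x
  have h2 : ‖(S ∘L T) x‖ ≤ ‖S‖ * ‖T x‖ := S.le_opNorm _
  rcases eq_or_lt_of_le (norm_nonneg (T x)) with h0 | h0
  · rw [← h0]; positivity
  · refine le_of_mul_le_mul_left ?_ h0
    nlinarith [norm_nonneg x]

variable (C) (E)

/-- The adjointable operators on `E`, as a subalgebra of the bounded operators. -/
def adjSubalgebra : Subalgebra ℂ (E →L[ℂ] E) where
  carrier := {T | IsAdjointable C T}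
  mul_mem' := by
    rintro T T' ⟨S, h⟩ ⟨S', h'⟩
    exact ⟨S' ∘L S, h'.comp h⟩
  add_mem' := by
    rintro T T' ⟨S, h⟩ ⟨S', h'⟩
    exact ⟨S + S', fun x y => by simp [h x y, h' x y]⟩
  algebraMap_mem' z := ⟨algebraMap ℂ _ (star z), fun x y => by
    simp [ContinuousLinearMap.algebraMap_apply]⟩

/-- The algebra `ℒ(E)` of adjointable operators on the Hilbert module `E`. -/
def AdjOp : Type w₁ := adjSubalgebra C E

variable {C E}

namespace AdjOp

/-- The bounded operator underlying an adjointable operator. -/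
def toCLM (T : AdjOp C E) : E →L[ℂ] E := T.1

@[ext] theorem ext {T T' : AdjOp C E} (h : T.toCLM = T'.toCLM) : T = T' := Subtype.ext h

instance : NormedRing (AdjOp C E) := inferInstanceAs (NormedRing (adjSubalgebra C E))
instance : NormedAlgebra ℂ (AdjOp C E) := inferInstanceAs (NormedAlgebra ℂ (adjSubalgebra C E))

@[simp] theorem toCLM_add (S T : AdjOp C E) : (S + T).toCLM = S.toCLM + T.toCLM := rfl
@[simp] theorem toCLM_sub (S T : AdjOp C E) : (S - T).toCLM = S.toCLM - T.toCLM := rfl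
@[simp] theorem toCLM_zero : (0 : AdjOp C E).toCLM = 0 := rfl
@[simp] theorem toCLM_one : (1 : AdjOp C E).toCLM = .id ℂ E := rfl
@[simp] theorem toCLM_mul (S T : AdjOp C E) : (S * T).toCLM = S.toCLM ∘L T.toCLM := rfl
@[simp] theorem toCLM_smul (z : ℂ) (T : AdjOp C E) : (z • T).toCLM = z • T.toCLM := rfl
theorem norm_def (T : AdjOp C E) : ‖T‖ = ‖T.toCLM‖ := rfl

@[simp] theorem toCLM_sum {ι : Type*} (s : Finset ι) (f : ι → AdjOp C E) :
    (∑ i ∈ s, f i).toCLM = ∑ i ∈ s, (f i).toCLM := by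
  classical
  induction s using Finset.induction_on with
  | empty => simp
  | insert a s ha ih => rw [Finset.sum_insert ha, Finset.sum_insert ha, toCLM_add, ih]

/-- The star operation of `ℒ(E)` is the adjoint. -/
instance : Star (AdjOp C E) where
  star T := ⟨T.2.choose, T.1, T.2.choose_spec.symm⟩

theorem isAdjointPair (T : AdjOp C E) : IsAdjointPair C T.toCLM (star T).toCLM := T.2.choose_spec

theorem star_eq_of_pair {T S : AdjOp C E} (h : IsAdjointPair C T.toCLM S.toCLM) : star T = S :=
  ext (T.isAdjointPair.unique h)

instance : StarRing (AdjOp C E) where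
  star_involutive T := star_eq_of_pair T.isAdjointPair.symm
  star_mul S T := star_eq_of_pair (T.isAdjointPair.comp S.isAdjointPair)
  star_add S T := star_eq_of_pair fun x y => by
    simp [S.isAdjointPair x y, T.isAdjointPair x y]

instance : StarModule ℂ (AdjOp C E) where
  star_smul z T := star_eq_of_pair fun x y => by simp [T.isAdjointPair x y]

instance : CStarRing (AdjOp C E) where
  norm_mul_self_le T := by
    rw [← pow_two]
    refine (Real.le_sqrt (norm_nonneg _) (norm_nonneg _)).mp ?_
    refine T.toCLM.opNorm_le_bound (Real.sqrt_nonneg _) fun x => ?_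
    refine le_of_sq_le_sq ?_ (by positivity)
    rw [mul_pow, Real.sq_sqrt (norm_nonneg _)]
    refine (T.isAdjointPair.norm_sq_le x).trans ?_
    have := ((star T).toCLM ∘L T.toCLM).le_opNorm x
    rw [norm_def, toCLM_mul]
    nlinarith [norm_nonneg x]

theorem isClosed_adjSubalgebra [CompleteSpace E] :
    IsClosed (adjSubalgebra C E : Set (E →L[ℂ] E)) := by
  refine isClosed_of_closure_subset fun T hT => ?_
  obtain ⟨t, ht, hlim⟩ := mem_closure_iff_seq_limit.mp hT
  choose s hs using ht
  have hc : CauchySeq s := by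
    rw [Metric.cauchySeq_iff]
    intro ε hε
    obtain ⟨N, hN⟩ := Metric.cauchySeq_iff.mp hlim.cauchySeq ε hε
    refine ⟨N, fun m hm n hn => lt_of_le_of_lt ?_ (hN m hm n hn)⟩
    rw [dist_eq_norm, dist_eq_norm]
    refine IsAdjointPair.norm_le (C := C) fun x y => ?_
    simp [(hs m).symm x y, (hs n).symm x y]
  obtain ⟨S, hS⟩ := cauchySeq_tendsto_of_complete hc
  refine ⟨S, fun x y => ?_⟩
  have h1 : Tendsto (fun n => inner C (t n x) y) atTop (𝓝 (inner C (T x) y)) :=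
    ((CStarModule.continuous_inner (A := C) (E := E)).tendsto (T x, y)).comp
      ((((ContinuousLinearMap.apply ℂ E x).continuous.tendsto T).comp hlim).prodMk_nhds
        tendsto_const_nhds)
  have h2 : Tendsto (fun n => inner C x (s n y)) atTop (𝓝 (inner C x (S y))) :=
    ((CStarModule.continuous_inner (A := C) (E := E)).tendsto (x, S y)).comp
      (tendsto_const_nhds.prodMk_nhds
        (((ContinuousLinearMap.apply ℂ E y).continuous.tendsto S).comp hS))
  exact tendsto_nhds_unique (h1.congr fun n => hs n x y) h2

instance [CompleteSpace E] : CompleteSpace (AdjOp C E) :=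
  (isClosed_adjSubalgebra (C := C) (E := E)).completeSpace_coe

/-- `ℒ(E)` is a unital C⋆-algebra for the operator norm. -/
instance [CompleteSpace E] : CStarAlgebra (AdjOp C E) where

/-- The usual order of the C⋆-algebra `ℒ(E)`. -/
instance [CompleteSpace E] : PartialOrder (AdjOp C E) := CStarAlgebra.spectralOrder _
instance [CompleteSpace E] : StarOrderedRing (AdjOp C E) := CStarAlgebra.spectralOrderedRing _

end AdjOp

end Adjointable

/-! ### The Hilbert module completion of a semi-inner product module -/

section Completion

variable (C : Type v) [NonUnitalCStarAlgebra C] [PartialOrder C] [StarOrderedRing C]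

/-- A `C`-valued semi-inner product `form` on a complex vector space `X` with an action `act` of
`C`; the form need not be definite. -/
structure SemiInner (X : Type w) [AddCommGroup X] [Module ℂ X] where
  form : X →ₗ⋆[ℂ] X →ₗ[ℂ] C
  act : C → X →ₗ[ℂ] X
  star_form : ∀ x y, star (form x y) = form y x
  form_nonneg : ∀ x, 0 ≤ form x x
  form_act : ∀ x c y, form x (act c y) = c * form x y

variable {C}
variable {X : Type w₁} [AddCommGroup X] [Module ℂ X]

namespace SemiInner

theorem form_act_left (P : SemiInner C X) (x : X) (c : C) (y : X) :
    P.form (P.act c x) y = P.form x y * star c := by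
  rw [← P.star_form, P.form_act, star_mul, P.star_form]

/-- The Cauchy–Schwarz inequality. -/
theorem norm_form_le (P : SemiInner C X) (x y : X) :
    ‖P.form x y‖ ^ 2 ≤ ‖P.form x x‖ * ‖P.form y y‖ := by
  refine le_of_forall_pos_le_add fun ε hε => ?_
  suffices H : ∀ t : ℝ, ‖P.form x x‖ < t → ‖P.form x y‖ ^ 2 ≤ t * ‖P.form y y‖ by
    have h1 := H (‖P.form x x‖ + ε / (‖P.form y y‖ + 1))
      (lt_add_of_pos_right _ (by positivity))
    refine h1.trans ?_
    have : ε / (‖P.form y y‖ + 1) * ‖P.form y y‖ ≤ ε := by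
      rw [div_mul_eq_mul_div, div_le_iff₀ (by positivity)]
      nlinarith [norm_nonneg (P.form y y)]
    rw [add_mul]
    linarith
  intro t ht
  have ht0 : 0 < t := (norm_nonneg _).trans_lt ht
  have key : ∀ a : C, 0 ≤ t • (a * star a) - t • (a * P.form y x)
      - t • (P.form x y * star a) + t • (t • P.form y y) := fun a => by
    calc (0 : C) ≤ P.form (P.act a x - (t : ℂ) • y) (P.act a x - (t : ℂ) • y) := P.form_nonneg _
      _ = a * P.form x x * star a - t • (a * P.form y x) - t • (P.form x y * star a)
            + t • (t • P.form y y) := by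
          have e1 : ∀ z, P.form z ((t : ℂ) • y) = t • P.form z y := fun z => by
            rw [map_smul, Complex.coe_smul]
          have e2 : ∀ z, P.form ((t : ℂ) • y) z = t • P.form y z := fun z => by
            rw [LinearMap.map_smulₛₗ₂, Complex.conj_ofReal, Complex.coe_smul]
          simp only [map_sub, LinearMap.sub_apply, e1, e2, P.form_act, P.form_act_left,
            mul_assoc]
          abel
      _ ≤ _ := by
          gcongr
          calc a * P.form x x * star a ≤ ‖P.form x x‖ • (a * star a) :=
                CStarAlgebra.star_right_conjugate_le_norm_smul
                  (hb := IsSelfAdjoint.of_nonneg (P.form_nonneg x))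
            _ ≤ t • (a * star a) := by
                have : (0 : C) ≤ a * star a := mul_star_self_nonneg a
                have h2 : 0 ≤ (t - ‖P.form x x‖) • (a * star a) :=
                  smul_nonneg (sub_nonneg.mpr ht.le) this
                rw [sub_smul] at h2
                exact sub_nonneg.mp h2
  have h1 := key (P.form x y)
  simp only [P.star_form, sub_self, zero_sub, le_neg_add_iff_add_le, add_zero] at h1
  rw [smul_le_smul_iff_of_pos_left ht0] at h1
  calc ‖P.form x y‖ ^ 2 = ‖P.form x y * P.form y x‖ := by
        rw [← P.star_form x y, CStarRing.norm_self_mul_star, pow_two]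
    _ ≤ ‖t • P.form y y‖ := by
        refine CStarAlgebra.norm_le_norm_of_nonneg_of_le ?_ h1
        rw [← P.star_form x y]
        exact mul_star_self_nonneg _
    _ = t * ‖P.form y y‖ := by rw [norm_smul, Real.norm_of_nonneg ht0.le]

/-- The space `X` with the seminorm `‖x‖ = √‖⟨x, x⟩‖`. -/
@[nolint unusedArguments]
def Pre (_ : SemiInner C X) : Type w₁ := X

variable (P : SemiInner C X)

/-- The identity map from `X` to its seminormed copy. -/
def toPre (x : X) : P.Pre := x

instance : AddCommGroup P.Pre := inferInstanceAs (AddCommGroup X)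
instance : Module ℂ P.Pre := inferInstanceAs (Module ℂ X)
instance : Inner C P.Pre := ⟨fun x y => P.form x y⟩
instance : Norm P.Pre := ⟨fun x => √‖P.form x x‖⟩
instance : SMul C P.Pre := ⟨fun c x => P.act c x⟩

theorem norm_sq (x : P.Pre) : ‖x‖ ^ 2 = ‖P.form x x‖ := Real.sq_sqrt (norm_nonneg _)

theorem norm_form_le' (x y : P.Pre) : ‖P.form x y‖ ≤ ‖x‖ * ‖y‖ := by
  have hx : 0 ≤ ‖x‖ := Real.sqrt_nonneg _
  have hy : 0 ≤ ‖y‖ := Real.sqrt_nonneg _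
  refine le_of_sq_le_sq ?_ (by positivity)
  rw [mul_pow, P.norm_sq, P.norm_sq]
  exact P.norm_form_le x y

theorem core : SeminormedSpace.Core ℂ P.Pre where
  norm_nonneg _ := Real.sqrt_nonneg _
  norm_smul z x := by
    have h : P.form (z • x : P.Pre) (z • x : P.Pre) = (star z * z) • P.form x x := by
      refine (LinearMap.map_smulₛₗ₂ P.form z x _).trans ?_
      refine (congrArg _ ((P.form x).map_smul z x)).trans ?_
      rw [smul_smul]
      rfl
    change √‖_‖ = ‖z‖ * √‖_‖
    rw [h, norm_smul, norm_mul, norm_star, Real.sqrt_mul (by positivity),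
      Real.sqrt_mul_self (norm_nonneg _)]
  norm_triangle x y := by
    have hx : 0 ≤ ‖x‖ := Real.sqrt_nonneg _
    have hy : 0 ≤ ‖y‖ := Real.sqrt_nonneg _
    refine le_of_sq_le_sq ?_ (by positivity)
    have h : P.form (x + y : P.Pre) (x + y : P.Pre)
        = P.form x x + P.form x y + (P.form y x + P.form y y) := by
      refine (LinearMap.map_add₂ P.form x y _).trans ?_
      exact congrArg₂ _ ((P.form x).map_add x y) ((P.form y).map_add x y)
    rw [P.norm_sq, h]
    have h1 := P.norm_form_le' x y
    have h2 := P.norm_form_le' y x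
    have h3 := P.norm_sq x
    have h4 := P.norm_sq y
    have h5 := norm_add_le (P.form x x + P.form x y) (P.form y x + P.form y y)
    have h6 := norm_add_le (P.form x x) (P.form x y)
    have h7 := norm_add_le (P.form y x) (P.form y y)
    nlinarith

instance : SeminormedAddCommGroup P.Pre := SeminormedAddCommGroup.ofCore P.core
instance : NormedSpace ℂ P.Pre where
  norm_smul_le z x := (P.core.norm_smul z x).le

theorem norm_act_le (c : C) (x : P.Pre) : ‖P.toPre (P.act c x)‖ ≤ ‖c‖ * ‖x‖ := by
  refine le_of_sq_le_sq ?_ (by positivity)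
  have h := P.norm_sq (P.toPre (P.act c x))
  have h' : P.form (P.toPre (P.act c x)) (P.toPre (P.act c x)) = c * (P.form x x * star c) :=
    (P.form_act _ c x).trans (congrArg _ (P.form_act_left x c x))
  rw [h, h', mul_pow, P.norm_sq]
  have h1 := norm_mul_le c (P.form x x * star c)
  have h2 := norm_mul_le (P.form x x) (star c)
  rw [norm_star] at h2
  nlinarith [norm_nonneg c]

theorem uniformContinuous_act (c : C) : UniformContinuous fun x : P.Pre => (c • x : P.Pre) := by
  have := (LinearMap.mkContinuous (show P.Pre →ₗ[ℂ] P.Pre from P.act c) ‖c‖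
    (P.norm_act_le c)).uniformContinuous
  exact this

instance : UniformContinuousConstSMul C P.Pre where
  uniformContinuous_const_smul := P.uniformContinuous_act

/-- The semi-inner product as a bounded sesquilinear map. -/
def formSL : P.Pre →L⋆[ℂ] P.Pre →L[ℂ] C :=
  LinearMap.mkContinuous₂ (show P.Pre →ₗ⋆[ℂ] P.Pre →ₗ[ℂ] C from P.form) 1 fun x y => by
    rw [one_mul]
    exact P.norm_form_le' x y

theorem continuous_inner_pre : Continuous fun p : P.Pre × P.Pre => (inner C p.1 p.2 : C) := by
  have : Continuous fun p : P.Pre × P.Pre => P.formSL p.1 p.2 := by fun_prop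
  exact this

theorem inner_coe (x y : P.Pre) :
    (inner C (x : Completion P.Pre) (y : Completion P.Pre) : C) = P.form x y :=
  (Completion.isDenseInducing_coe.prodMap Completion.isDenseInducing_coe).extend_eq
    P.continuous_inner_pre (x, y)

theorem continuous_inner_compl :
    Continuous fun p : Completion P.Pre × Completion P.Pre => (inner C p.1 p.2 : C) := by
  let f : P.Pre →+ P.Pre →+ C :=
    { toFun := fun x => (P.formSL x).toLinearMap.toAddMonoidHom
      map_zero' := by ext; simp
      map_add' := fun x y => by ext; simp }
  have h : Continuous fun p : P.Pre × P.Pre => f p.1 p.2 := P.continuous_inner_pre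
  exact (Completion.isDenseInducing_toCompl P.Pre).extend_Z_bilin
    (Completion.isDenseInducing_toCompl P.Pre) h

theorem continuous_inner_compl' {Z : Type*} [TopologicalSpace Z] {f g : Z → Completion P.Pre}
    (hf : Continuous f) (hg : Continuous g) : Continuous fun z => (inner C (f z) (g z) : C) :=
  P.continuous_inner_compl.comp (hf.prodMk hg)

theorem norm_eq_compl (x : Completion P.Pre) : ‖x‖ = √‖(inner C x x : C)‖ := by
  induction x using Completion.induction_on with
  | hp =>
    exact isClosed_eq continuous_norm
      (Real.continuous_sqrt.comp
        (continuous_norm.comp (P.continuous_inner_compl' continuous_id continuous_id)))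
  | ih x => rw [Completion.norm_coe, P.inner_coe]; rfl

/-- The completion is a Hilbert `C`-module. -/
abbrev completionCStarModule : CStarModule C (Completion P.Pre) where
  inner_add_right {x y z} := by
    induction x, y, z using Completion.induction_on₃ with
    | hp =>
      refine isClosed_eq (P.continuous_inner_compl' (by fun_prop) (by fun_prop))
        (.add (P.continuous_inner_compl' ?_ ?_) (P.continuous_inner_compl' ?_ ?_)) <;> fun_prop
    | ih x y z =>
      rw [← Completion.coe_add, P.inner_coe, P.inner_coe, P.inner_coe]
      exact (P.form x).map_add y z
  inner_self_nonneg {x} := by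
    induction x using Completion.induction_on with
    | hp =>
      exact (CStarAlgebra.isClosed_nonneg (A := C)).preimage
        (P.continuous_inner_compl' continuous_id continuous_id)
    | ih x => rw [P.inner_coe]; exact P.form_nonneg x
  inner_self {x} := by
    have h := P.norm_eq_compl x
    constructor
    · intro h0
      rw [h0, norm_zero, Real.sqrt_zero] at h
      exact norm_eq_zero.mp h
    · rintro rfl
      rw [norm_zero] at h
      exact norm_eq_zero.mp ((Real.sqrt_eq_zero (norm_nonneg _)).mp h.symm)
  inner_op_smul_right {c x y} := by
    induction x, y using Completion.induction_on₂ with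
    | hp =>
      refine isClosed_eq (P.continuous_inner_compl' continuous_fst
        ((continuous_const_smul c).comp continuous_snd))
        (continuous_const.mul (P.continuous_inner_compl' continuous_fst continuous_snd))
    | ih x y =>
      rw [← Completion.coe_smul, P.inner_coe, P.inner_coe]
      exact P.form_act x c y
  inner_smul_right_complex {c x y} := by
    induction x, y using Completion.induction_on₂ with
    | hp =>
      refine isClosed_eq (P.continuous_inner_compl' continuous_fst
        (continuous_snd.const_smul c))
        ((P.continuous_inner_compl' continuous_fst continuous_snd).const_smul c)
    | ih x y =>
      rw [← Completion.coe_smul, P.inner_coe, P.inner_coe]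
      exact (P.form x).map_smul c y
  star_inner x y := by
    induction x, y using Completion.induction_on₂ with
    | hp =>
      exact isClosed_eq (P.continuous_inner_compl' continuous_fst continuous_snd).star
        (P.continuous_inner_compl' continuous_snd continuous_fst)
    | ih x y => rw [P.inner_coe, P.inner_coe]; exact P.star_form x y
  norm_eq_sqrt_norm_inner_self x := P.norm_eq_compl x

/-- The Hilbert `C`-module obtained by completing `X / {x | ⟨x, x⟩ = 0}`. -/
def Compl : Type w₁ := Completion P.Pre

instance : NormedAddCommGroup P.Compl := inferInstanceAs (NormedAddCommGroup (Completion P.Pre))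
instance : NormedSpace ℂ P.Compl := inferInstanceAs (NormedSpace ℂ (Completion P.Pre))
instance : CompleteSpace P.Compl := inferInstanceAs (CompleteSpace (Completion P.Pre))
instance : SMul C P.Compl := inferInstanceAs (SMul C (Completion P.Pre))
instance : CStarModule C P.Compl := P.completionCStarModule

/-- The canonical map of `X` into the completion, with dense range and kernel
`{x | ⟨x, x⟩ = 0}`. -/
def toCompl (x : X) : P.Compl := (P.toPre x : Completion P.Pre)

theorem inner_toCompl (x y : X) : (inner C (P.toCompl x) (P.toCompl y) : C) = P.form x y :=
  P.inner_coe x y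

theorem norm_toCompl_sq (x : X) : ‖P.toCompl x‖ ^ 2 = ‖P.form x x‖ := by
  rw [CStarModule.norm_sq_eq C, P.inner_toCompl]

theorem toCompl_add (x y : X) : P.toCompl (x + y) = P.toCompl x + P.toCompl y :=
  Completion.coe_add (P.toPre x) (P.toPre y)

theorem toCompl_smul (z : ℂ) (x : X) : P.toCompl (z • x) = z • P.toCompl x :=
  Completion.coe_smul z (P.toPre x)

theorem toCompl_zero : P.toCompl 0 = 0 := Completion.coe_zero

theorem denseRange_toCompl : DenseRange P.toCompl :=
  (Completion.denseRange_coe : DenseRange ((↑) : P.Pre → Completion P.Pre))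

theorem norm_toCompl (x : X) : ‖P.toCompl x‖ = ‖P.toPre x‖ := Completion.norm_coe (P.toPre x)

variable {Y : Type w₂} [AddCommGroup Y] [Module ℂ Y] {P} {Q : SemiInner C Y}

/-- A linear map regarded as a map of seminormed spaces. -/
def preMap (T : X →ₗ[ℂ] Y) : P.Pre →ₗ[ℂ] Q.Pre := T

/-- The extension of a bounded linear map to the completions. -/
def liftCLM (T : X →ₗ[ℂ] Y) (K : ℝ) (h : ∀ x, ‖Q.toCompl (T x)‖ ≤ K * ‖P.toCompl x‖) :
    P.Compl →L[ℂ] Q.Compl :=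
  ContinuousLinearMap.completion (LinearMap.mkContinuous (preMap T) K fun x =>
    (Q.norm_toCompl (T x)).symm.trans_le ((h x).trans_eq (congrArg _ (P.norm_toCompl x))))

theorem liftCLM_toCompl (T : X →ₗ[ℂ] Y) (K : ℝ)
    (h : ∀ x, ‖Q.toCompl (T x)‖ ≤ K * ‖P.toCompl x‖) (x : X) :
    liftCLM T K h (P.toCompl x) = Q.toCompl (T x) :=
  ContinuousLinearMap.completion_apply_coe _ _

theorem norm_liftCLM_bound {T : X →ₗ[ℂ] Y} {K : ℝ} (hK : 0 ≤ K)
    (h : ∀ x, ‖Q.form (T x) (T x)‖ ≤ K ^ 2 * ‖P.form x x‖) (x : X) :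
    ‖Q.toCompl (T x)‖ ≤ K * ‖P.toCompl x‖ := by
  refine le_of_sq_le_sq ?_ (by positivity)
  rw [mul_pow, norm_toCompl_sq, norm_toCompl_sq]
  exact h x

theorem isAdjointPair_of_dense {S : P.Compl →L[ℂ] Q.Compl} {T : Q.Compl →L[ℂ] P.Compl}
    (h : ∀ x y, (inner C (S (P.toCompl x)) (Q.toCompl y) : C)
      = inner C (P.toCompl x) (T (Q.toCompl y))) : IsAdjointPair C S T := by
  have hc : Continuous fun p : P.Compl × Q.Compl => (inner C (S p.1) p.2 : C) :=
    (CStarModule.continuous_inner (A := C) (E := Q.Compl)).comp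
      ((S.continuous.comp continuous_fst).prodMk continuous_snd)
  have hc' : Continuous fun p : P.Compl × Q.Compl => (inner C p.1 (T p.2) : C) :=
    (CStarModule.continuous_inner (A := C) (E := P.Compl)).comp
      (continuous_fst.prodMk (T.continuous.comp continuous_snd))
  have := (P.denseRange_toCompl.prodMap Q.denseRange_toCompl).equalizer hc hc'
    (funext fun p => h p.1 p.2)
  exact fun x y => congrFun this (x, y)

end SemiInner

end Completion

/-! ### The Hilbert module `A ⊗_φ E` and the representation `π_φ` -/

section KSGNS

variable {A : Type u} [NonUnitalCStarAlgebra A] [PartialOrder A] [StarOrderedRing A]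
variable {C : Type v} [NonUnitalCStarAlgebra C] [PartialOrder C] [StarOrderedRing C]
variable {E : Type w₁} [NormedAddCommGroup E] [NormedSpace ℂ E] [SMul C E] [CStarModule C E]
  [CompleteSpace E]
variable {F : Type w₂} [NormedAddCommGroup F] [NormedSpace ℂ F] [SMul C F] [CStarModule C F]
  [CompleteSpace F]

/-- The action of `c : C` on a Hilbert `C`-module is complex linear. -/
def smulLin (E : Type w₁) [NormedAddCommGroup E] [NormedSpace ℂ E] [SMul C E] [CStarModule C E]
    (c : C) : E →ₗ[ℂ] E where
  toFun x := c • x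
  map_add' x y := ext_inner (C := C) fun z => by simp [mul_add]
  map_smul' r x := ext_inner (C := C) fun z => by simp [mul_smul_comm]

theorem tmul_induction₂ {p : A ⊗[ℂ] E → A ⊗[ℂ] F → Prop} (h0 : ∀ w, p 0 w) (h0' : ∀ z, p z 0)
    (ha : ∀ z z' w, p z w → p z' w → p (z + z') w)
    (ha' : ∀ z w w', p z w → p z w' → p z (w + w'))
    (ht : ∀ a x b y, p (a ⊗ₜ x) (b ⊗ₜ y)) (z : A ⊗[ℂ] E) (w : A ⊗[ℂ] F) : p z w := by
  induction z using TensorProduct.induction_on with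
  | zero => exact h0 w
  | add z z' h h' => exact ha _ _ _ h h'
  | tmul a x =>
    induction w using TensorProduct.induction_on with
    | zero => exact h0' _
    | add w w' h h' => exact ha' _ _ _ h h'
    | tmul b y => exact ht a x b y

theorem toCLM_smul_right (T : AdjOp C E) (c : C) (x : E) :
    T.toCLM (c • x) = c • T.toCLM x := ext_inner (C := C) fun z => by
  rw [← T.isAdjointPair.symm, CStarModule.inner_op_smul_right, CStarModule.inner_op_smul_right,
    T.isAdjointPair.symm]

/-- The linear map `b ⊗ y ↦ ⟨x, φ(a⋆ b) y⟩`. -/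
def ksFormAux (φ : A →CP AdjOp C E) (a : A) (x : E) : A ⊗[ℂ] E →ₗ[ℂ] C :=
  TensorProduct.lift (LinearMap.mk₂ ℂ
    (fun (b : A) (y : E) => (inner C x ((φ (star a * b)).toCLM y) : C))
    (fun b b' y => by
      rw [mul_add, map_add, AdjOp.toCLM_add, add_apply,
        CStarModule.inner_add_right])
    (fun z b y => by
      rw [mul_smul_comm, map_smul, AdjOp.toCLM_smul, smul_apply,
        CStarModule.inner_smul_right_complex])
    (fun b y y' => by rw [map_add, CStarModule.inner_add_right])
    (fun z b y => by rw [map_smul, CStarModule.inner_smul_right_complex]))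

@[simp] theorem ksFormAux_tmul (φ : A →CP AdjOp C E) (a b : A) (x y : E) :
    ksFormAux φ a x (b ⊗ₜ y) = inner C x ((φ (star a * b)).toCLM y) := rfl

/-- The `C`-valued form on `A ⊗ E` with `⟨a ⊗ x, b ⊗ y⟩ = ⟨x, φ(a⋆ b) y⟩`. -/
def ksForm (φ : A →CP AdjOp C E) : A ⊗[ℂ] E →ₗ⋆[ℂ] A ⊗[ℂ] E →ₗ[ℂ] C :=
  TensorProduct.lift (LinearMap.mk₂'ₛₗ (starRingEnd ℂ) (starRingEnd ℂ) (ksFormAux φ)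
    (fun a a' x => TensorProduct.ext' fun b y => by
      rw [LinearMap.add_apply, ksFormAux_tmul, ksFormAux_tmul, ksFormAux_tmul, star_add, add_mul,
        map_add, AdjOp.toCLM_add, add_apply, CStarModule.inner_add_right])
    (fun z a x => TensorProduct.ext' fun b y => by
      rw [LinearMap.smul_apply, ksFormAux_tmul, ksFormAux_tmul, star_smul, smul_mul_assoc,
        map_smul, AdjOp.toCLM_smul, smul_apply,
        CStarModule.inner_smul_right_complex]
      rfl)
    (fun a x x' => TensorProduct.ext' fun b y => by
      rw [LinearMap.add_apply, ksFormAux_tmul, ksFormAux_tmul, ksFormAux_tmul,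
        CStarModule.inner_add_left])
    (fun z a x => TensorProduct.ext' fun b y => by
      rw [LinearMap.smul_apply, ksFormAux_tmul, ksFormAux_tmul,
        CStarModule.inner_smul_left_complex]
      rfl))

theorem nonneg_iff_star_mul {M : Type*} [NonUnitalCStarAlgebra M] [PartialOrder M]
    [StarOrderedRing M] {a : M} : 0 ≤ a ↔ ∃ b, a = star b * b :=
  CStarAlgebra.nonneg_iff_eq_star_mul_self

@[simp] theorem ksForm_tmul (φ : A →CP AdjOp C E) (a b : A) (x y : E) :
    ksForm φ (a ⊗ₜ x) (b ⊗ₜ y) = inner C x ((φ (star a * b)).toCLM y) := rfl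

theorem map_star_cp (φ : A →CP AdjOp C E) (a : A) : φ (star a) = star (φ a) := map_star φ a

theorem ksForm_star (φ : A →CP AdjOp C E) (z w : A ⊗[ℂ] E) :
    star (ksForm φ z w) = ksForm φ w z := by
  refine tmul_induction₂ (p := fun z w => star (ksForm φ z w) = ksForm φ w z) ?_ ?_ ?_ ?_ ?_ z w
  · simp
  · simp
  · intro z z' w h h'; simp [h, h']
  · intro z w w' h h'; simp [h, h']
  · intro a x b y
    rw [ksForm_tmul, ksForm_tmul, CStarModule.star_inner, (φ (star a * b)).isAdjointPair,
      ← map_star_cp, star_mul, star_star]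

theorem ksForm_nonneg (φ : A →CP AdjOp C E) (z : A ⊗[ℂ] E) : 0 ≤ ksForm φ z z := by
  classical
  obtain ⟨S, rfl⟩ := TensorProduct.exists_finset z
  rcases S.eq_empty_or_nonempty with rfl | ⟨s₀, hs₀⟩
  · simp
  let N : CStarMatrix S S A := fun k i => if k = ⟨s₀, hs₀⟩ then i.1.1 else 0
  have hN : ∀ i j, (star N * N) i j = star i.1.1 * j.1.1 := fun i j => by
    rw [CStarMatrix.mul_apply]
    have : ∀ k : S, (star N) i k = star (N k i) := fun k => rfl
    simp only [this, N]
    simp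
  have hpos := φ.map_cstarMatrix_nonneg (star N * N) (star_mul_self_nonneg N)
  obtain ⟨D, hD⟩ := nonneg_iff_star_mul.mp hpos
  have hφ : ∀ i j : S, φ (star i.1.1 * j.1.1) = ∑ k, star (D k i) * D k j := fun i j => by
    rw [← hN, ← CStarMatrix.map_apply (f := φ) (M := star N * N), hD, CStarMatrix.mul_apply]
    rfl
  have hsum : (∑ i ∈ S, i.1 ⊗ₜ[ℂ] i.2) = ∑ i : S, i.1.1 ⊗ₜ[ℂ] i.1.2 :=
    (Finset.sum_coe_sort S fun i => i.1 ⊗ₜ[ℂ] i.2).symm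
  have hval : ksForm φ (∑ i ∈ S, i.1 ⊗ₜ[ℂ] i.2) (∑ i ∈ S, i.1 ⊗ₜ[ℂ] i.2)
      = ∑ k : S, (inner C (∑ i : S, (D k i).toCLM i.1.2) (∑ i : S, (D k i).toCLM i.1.2) : C) := by
    rw [hsum]
    simp only [map_sum, LinearMap.sum_apply, ksForm_tmul, CStarModule.inner_sum_right,
      CStarModule.inner_sum_left]
    have hterm : ∀ i j : S, (inner C i.1.2 ((φ (star i.1.1 * j.1.1)).toCLM j.1.2) : C)
        = ∑ k : S, (inner C ((D k i).toCLM i.1.2) ((D k j).toCLM j.1.2) : C) := fun i j => by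
      rw [hφ, AdjOp.toCLM_sum, sum_apply, CStarModule.inner_sum_right]
      exact Finset.sum_congr rfl fun k _ => ((D k i).isAdjointPair _ _).symm
    simp only [hterm]
    refine (Finset.sum_congr rfl fun i _ => Finset.sum_comm).trans ?_
    exact Finset.sum_comm
  rw [hval]
  exact Finset.sum_nonneg fun k _ => CStarModule.inner_self_nonneg

/-- The semi-inner product module `A ⊗ E`, with `C` acting on `E`. -/
def ksSemiInner (φ : A →CP AdjOp C E) : SemiInner C (A ⊗[ℂ] E) where
  form := ksForm φ
  act c := LinearMap.lTensor A (smulLin E c)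
  star_form := ksForm_star φ
  form_nonneg := ksForm_nonneg φ
  form_act z c w := by
    refine tmul_induction₂ (p := fun z w => ksForm φ z (LinearMap.lTensor A (smulLin E c) w)
      = c * ksForm φ z w) ?_ ?_ ?_ ?_ ?_ z w
    · simp
    · simp
    · intro z z' w h h'; simp only [map_add, LinearMap.add_apply, h, h', mul_add]
    · intro z w w' h h'; simp only [map_add, h, h', mul_add]
    · intro a x b y
      rw [LinearMap.lTensor_tmul, ksForm_tmul, ksForm_tmul,
        ← CStarModule.inner_op_smul_right (A := C), ← toCLM_smul_right]
      rfl

/-- The Hilbert module `A ⊗_φ E`. -/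
abbrev KSModule (φ : A →CP AdjOp C E) : Type (max u w₁) := (ksSemiInner φ).Compl

/-- The class `a ⊗̇ x` in `A ⊗_φ E` of a simple tensor. -/
def dtmul (φ : A →CP AdjOp C E) (a : A) (x : E) : KSModule φ := (ksSemiInner φ).toCompl (a ⊗ₜ x)

theorem inner_dtmul (φ : A →CP AdjOp C E) (a b : A) (x y : E) :
    (inner C (dtmul φ a x) (dtmul φ b y) : C) = inner C x ((φ (star a * b)).toCLM y) :=
  (ksSemiInner φ).inner_toCompl _ _

/-- Continuous linear maps out of `A ⊗_φ E` are determined by their values on simple tensors. -/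
theorem ext_dtmul {φ : A →CP AdjOp C E} {G : Type w₃} [NormedAddCommGroup G] [NormedSpace ℂ G]
    {S T : KSModule φ →L[ℂ] G} (h : ∀ a x, S (dtmul φ a x) = T (dtmul φ a x)) : S = T := by
  refine ContinuousLinearMap.coeFn_injective
    ((ksSemiInner φ).denseRange_toCompl.equalizer S.continuous T.continuous ?_)
  funext z
  induction z using TensorProduct.induction_on with
  | zero => simp [SemiInner.toCompl_zero]
  | tmul a x => exact h a x
  | add z w hz hw =>
    simp only [Function.comp_apply] at hz hw ⊢
    rw [SemiInner.toCompl_add, map_add, map_add, hz, hw]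

theorem isAdjointPair_of_dtmul {φ : A →CP AdjOp C E} {ψ : A →CP AdjOp C F}
    {S : KSModule φ →L[ℂ] KSModule ψ} {T : KSModule ψ →L[ℂ] KSModule φ}
    (h : ∀ a x b y, (inner C (S (dtmul φ a x)) (dtmul ψ b y) : C)
      = inner C (dtmul φ a x) (T (dtmul ψ b y))) : IsAdjointPair C S T := by
  refine SemiInner.isAdjointPair_of_dense fun z w => ?_
  refine tmul_induction₂ (p := fun z w =>
    (inner C (S ((ksSemiInner φ).toCompl z)) ((ksSemiInner ψ).toCompl w) : C)
      = inner C ((ksSemiInner φ).toCompl z) (T ((ksSemiInner ψ).toCompl w))) ?_ ?_ ?_ ?_ h z w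
  · intro w
    rw [SemiInner.toCompl_zero, map_zero, CStarModule.inner_zero_left, CStarModule.inner_zero_left]
  · intro z
    rw [SemiInner.toCompl_zero, map_zero, CStarModule.inner_zero_right,
      CStarModule.inner_zero_right]
  · intro z z' w h h'
    rw [SemiInner.toCompl_add, map_add, CStarModule.inner_add_left, CStarModule.inner_add_left,
      h, h']
  · intro z w w' h h'
    rw [SemiInner.toCompl_add, map_add, CStarModule.inner_add_right,
      CStarModule.inner_add_right, h, h']

theorem ks_bound {φ : A →CP AdjOp C E} {ψ : A →CP AdjOp C F}
    {T : A ⊗[ℂ] E →ₗ[ℂ] A ⊗[ℂ] F} {D : A ⊗[ℂ] E →ₗ[ℂ] A ⊗[ℂ] E} {K : ℝ} (hK : 0 ≤ K)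
    (h : ∀ a x b y, ksForm ψ (T (a ⊗ₜ x)) (T (b ⊗ₜ y)) + ksForm φ (D (a ⊗ₜ x)) (D (b ⊗ₜ y))
      = (K ^ 2) • ksForm φ (a ⊗ₜ x) (b ⊗ₜ y)) (z : A ⊗[ℂ] E) :
    ‖(ksSemiInner ψ).toCompl (T z)‖ ≤ K * ‖(ksSemiInner φ).toCompl z‖ := by
  refine SemiInner.norm_liftCLM_bound (P := ksSemiInner φ) (Q := ksSemiInner ψ) hK
    (fun z => ?_) z
  have hz : ksForm ψ (T z) (T z) + ksForm φ (D z) (D z) = (K ^ 2) • ksForm φ z z := by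
    refine tmul_induction₂ (p := fun z w => ksForm ψ (T z) (T w) + ksForm φ (D z) (D w)
      = (K ^ 2) • ksForm φ z w) ?_ ?_ ?_ ?_ h z z
    · simp
    · simp
    · intro z z' w h h'
      simp only [map_add, LinearMap.add_apply, smul_add, ← h, ← h']
      abel
    · intro z w w' h h'
      simp only [map_add, smul_add, ← h, ← h']
      abel
  change ‖ksForm ψ (T z) (T z)‖ ≤ K ^ 2 * ‖ksForm φ z z‖
  have h1 : ksForm ψ (T z) (T z) ≤ (K ^ 2) • ksForm φ z z := by
    rw [← hz]
    exact le_add_of_nonneg_right (ksForm_nonneg φ _)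
  have h2 := CStarAlgebra.norm_le_norm_of_nonneg_of_le (ksForm_nonneg ψ _) h1
  rwa [norm_smul, Real.norm_of_nonneg (by positivity)] at h2

/-- Left multiplication by `a` on `A ⊗ E`. -/
def leftMul (E : Type w₁) [NormedAddCommGroup E] [NormedSpace ℂ E] (a : A) :
    A ⊗[ℂ] E →ₗ[ℂ] A ⊗[ℂ] E := LinearMap.rTensor E (LinearMap.mulLeft ℂ a)

theorem exists_defect (a : A) : ∃ D : A →ₗ[ℂ] A, ∀ b c,
    star (a * b) * (a * c) + star (D b) * D c = (‖a‖ ^ 2 : ℝ) • (star b * c) := by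
  have hle : star (a : Unitization ℂ A) * a ≤ algebraMap ℝ _ (‖a‖ ^ 2) := by
    have := CStarAlgebra.star_mul_le_algebraMap_norm_sq (a := (a : Unitization ℂ A))
    rwa [Unitization.norm_inr] at this
  obtain ⟨c, hc⟩ := CStarAlgebra.nonneg_iff_eq_star_mul_self.mp (sub_nonneg.mpr hle)
  let D : A →ₗ[ℂ] A := c.fst • LinearMap.id + LinearMap.mulLeft ℂ c.snd
  have hD : ∀ b : A, ((D b : A) : Unitization ℂ A) = c * b := fun b => by
    ext <;> simp [D]
  refine ⟨D, fun b d => ?_⟩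
  apply Unitization.inr_injective (R := ℂ)
  simp only [Unitization.inr_add, Unitization.inr_mul, Unitization.inr_star, hD,
    Unitization.inr_smul, star_mul]
  calc _ = star (b : Unitization ℂ A) * (star (a : Unitization ℂ A) * a + star c * c) * d := by
        noncomm_ring
    _ = _ := by
        rw [← hc, add_sub_cancel, Algebra.algebraMap_eq_smul_one]
        simp

theorem leftMul_bound (φ : A →CP AdjOp C E) (a : A) (z : A ⊗[ℂ] E) :
    ‖(ksSemiInner φ).toCompl (leftMul E a z)‖ ≤ ‖a‖ * ‖(ksSemiInner φ).toCompl z‖ := by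
  obtain ⟨D, hD⟩ := exists_defect a
  refine ks_bound (D := LinearMap.rTensor E D) (norm_nonneg a) (fun b x c y => ?_) z
  simp only [leftMul, LinearMap.rTensor_tmul, LinearMap.mulLeft_apply, ksForm_tmul]
  rw [← CStarModule.inner_add_right, ← add_apply, ← AdjOp.toCLM_add,
    ← map_add, hD, ← Complex.coe_smul, map_smul, AdjOp.toCLM_smul,
    smul_apply, CStarModule.inner_smul_right_complex, Complex.coe_smul]

/-- The bounded operator `π_φ(a)` on `A ⊗_φ E`, with `π_φ(a)(b ⊗̇ x) = ab ⊗̇ x`. -/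
def piCLM (φ : A →CP AdjOp C E) (a : A) : KSModule φ →L[ℂ] KSModule φ :=
  SemiInner.liftCLM (leftMul E a) ‖a‖ (leftMul_bound φ a)

@[simp] theorem piCLM_dtmul (φ : A →CP AdjOp C E) (a b : A) (x : E) :
    piCLM φ a (dtmul φ b x) = dtmul φ (a * b) x :=
  SemiInner.liftCLM_toCompl _ _ _ _

theorem piCLM_pair (φ : A →CP AdjOp C E) (a : A) :
    IsAdjointPair C (piCLM φ a) (piCLM φ (star a)) :=
  isAdjointPair_of_dtmul fun b x c y => by
    simp [inner_dtmul, mul_assoc]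

theorem dtmul_add_left (φ : A →CP AdjOp C E) (a b : A) (x : E) :
    dtmul φ (a + b) x = dtmul φ a x + dtmul φ b x := by
  rw [dtmul, TensorProduct.add_tmul, SemiInner.toCompl_add]; rfl

theorem dtmul_smul_left (φ : A →CP AdjOp C E) (z : ℂ) (a : A) (x : E) :
    dtmul φ (z • a) x = z • dtmul φ a x := by
  rw [dtmul, ← TensorProduct.smul_tmul', SemiInner.toCompl_smul]; rfl

theorem dtmul_add_right (φ : A →CP AdjOp C E) (a : A) (x y : E) :
    dtmul φ a (x + y) = dtmul φ a x + dtmul φ a y := by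
  rw [dtmul, TensorProduct.tmul_add, SemiInner.toCompl_add]; rfl

theorem dtmul_smul_right (φ : A →CP AdjOp C E) (z : ℂ) (a : A) (x : E) :
    dtmul φ a (z • x) = z • dtmul φ a x := by
  rw [dtmul, TensorProduct.tmul_smul, SemiInner.toCompl_smul]; rfl

theorem dtmul_sub_left (φ : A →CP AdjOp C E) (a b : A) (x : E) :
    dtmul φ (a - b) x = dtmul φ a x - dtmul φ b x := by
  rw [eq_sub_iff_add_eq, ← dtmul_add_left, sub_add_cancel]

/-- The adjointable operator `π_φ(a)`. -/
def piOp (φ : A →CP AdjOp C E) (a : A) : AdjOp C (KSModule φ) :=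
  ⟨piCLM φ a, piCLM φ (star a), piCLM_pair φ a⟩

@[simp] theorem piOp_toCLM (φ : A →CP AdjOp C E) (a : A) : (piOp φ a).toCLM = piCLM φ a := rfl

/-- The ⋆-homomorphism `π_φ : A → ℒ(A ⊗_φ E)`. -/
def piHom (φ : A →CP AdjOp C E) : A →⋆ₙₐ[ℂ] AdjOp C (KSModule φ) where
  toFun := piOp φ
  map_smul' z a := AdjOp.ext <| ext_dtmul fun b x => by
    rw [AdjOp.toCLM_smul, smul_apply, piOp_toCLM, piOp_toCLM, piCLM_dtmul,
      piCLM_dtmul, smul_mul_assoc, dtmul_smul_left]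
    rfl
  map_zero' := AdjOp.ext <| ext_dtmul fun b x => by
    rw [piOp_toCLM, piCLM_dtmul, zero_mul, ← zero_smul ℂ (0 : A), dtmul_smul_left, zero_smul]
    rfl
  map_add' a a' := AdjOp.ext <| ext_dtmul fun b x => by
    rw [AdjOp.toCLM_add, add_apply, piOp_toCLM, piOp_toCLM, piOp_toCLM,
      piCLM_dtmul, piCLM_dtmul, piCLM_dtmul, add_mul, dtmul_add_left]
  map_mul' a a' := AdjOp.ext <| ext_dtmul fun b x => by
    rw [AdjOp.toCLM_mul, ContinuousLinearMap.comp_apply, piOp_toCLM, piOp_toCLM, piOp_toCLM,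
      piCLM_dtmul, piCLM_dtmul, piCLM_dtmul, mul_assoc]
  map_star' a := (AdjOp.star_eq_of_pair (T := piOp φ a) (S := piOp φ (star a))
    (piCLM_pair φ a)).symm

/-- `π_φ` as a completely positive map. -/
def piCP (φ : A →CP AdjOp C E) : A →CP AdjOp C (KSModule φ) :=
  CompletelyPositiveMapClass.toCompletelyPositiveLinearMap (piHom φ)

@[simp] theorem piCP_toCLM (φ : A →CP AdjOp C E) (a : A) : (piCP φ a).toCLM = piCLM φ a := rfl

/-! ### Functoriality of `A ⊗_φ E` -/

/-- `α ⊗ η` on the algebraic tensor products. -/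
def tensorMap (η : E →L[ℂ] F) (α : A ≃⋆ₐ[ℂ] A) : A ⊗[ℂ] E →ₗ[ℂ] A ⊗[ℂ] F :=
  TensorProduct.map { toFun := α, map_add' := map_add α, map_smul' := map_smul α } η.toLinearMap

theorem tensorMap_bound {φ : A →CP AdjOp C E} {ψ : A →CP AdjOp C F} {η : E →L[ℂ] F}
    (hη : IsAdjointable C η) {α : A ≃⋆ₐ[ℂ] A}
    (h : ∀ a, (ψ (α a)).toCLM ∘L η = η ∘L (φ a).toCLM) :
    ∃ K : ℝ, ∀ z, ‖(ksSemiInner ψ).toCompl (tensorMap η α z)‖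
      ≤ K * ‖(ksSemiInner φ).toCompl z‖ := by
  obtain ⟨ηs, hs⟩ := hη
  let S : AdjOp C E := ⟨ηs ∘L η, ηs ∘L η, hs.comp hs.symm⟩
  have hSsa : IsSelfAdjoint S := AdjOp.star_eq_of_pair (S := S) (hs.comp hs.symm)
  have h' : ∀ a, ηs ∘L (ψ (α a)).toCLM = (φ a).toCLM ∘L ηs := fun a => by
    have h1 : IsAdjointPair C ((ψ (α (star a))).toCLM ∘L η) (ηs ∘L (ψ (α a)).toCLM) := by
      have := (ψ (α (star a))).isAdjointPair
      rw [← map_star_cp, ← map_star, star_star] at this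
      exact hs.comp this
    have h2 : IsAdjointPair C (η ∘L (φ (star a)).toCLM) ((φ a).toCLM ∘L ηs) := by
      have := (φ (star a)).isAdjointPair
      rw [← map_star_cp, star_star] at this
      exact this.comp hs
    rw [h] at h1
    exact h1.unique h2
  have hcomm : ∀ a, Commute S (φ a) := fun a => AdjOp.ext <| by
    change (ηs ∘L η) ∘L (φ a).toCLM = (φ a).toCLM ∘L (ηs ∘L η)
    rw [ContinuousLinearMap.comp_assoc, ← h, ← ContinuousLinearMap.comp_assoc, h',
      ContinuousLinearMap.comp_assoc]
  let R : AdjOp C E := algebraMap ℝ _ ‖S‖ - S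
  have hR : 0 ≤ R := sub_nonneg.mpr hSsa.le_algebraMap_norm_self
  have hRcomm : ∀ a, Commute R (φ a) := fun a => 
    (show Commute (algebraMap ℝ (AdjOp C E) ‖S‖) (φ a) from Algebra.commutes _ _).sub_left (hcomm a)
  let d : AdjOp C E := CFC.sqrt R
  have hdd : d * d = R := CFC.sqrt_mul_sqrt_self R hR
  have hdsa : star d = d := (IsSelfAdjoint.of_nonneg (CFC.sqrt_nonneg R)).star_eq
  have hdcomm : ∀ a, Commute d (φ a) := fun a => (hRcomm a).cfcₙ_nnreal _
  refine ⟨√‖S‖, fun z => ?_⟩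
  refine ks_bound (D := LinearMap.lTensor A (d.toCLM.toLinearMap)) (Real.sqrt_nonneg _)
    (fun a x b y => ?_) z
  rw [Real.sq_sqrt (norm_nonneg _)]
  change (inner C (η x) ((ψ (star (α a) * α b)).toCLM (η y)) : C)
      + inner C (d.toCLM x) ((φ (star a * b)).toCLM (d.toCLM y))
    = ‖S‖ • (inner C x ((φ (star a * b)).toCLM y) : C)
  have e1 : (ψ (star (α a) * α b)).toCLM (η y) = η ((φ (star a * b)).toCLM y) := by
    rw [← map_star, ← map_mul]
    exact congrArg (fun T => T y) (h (star a * b))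
  have e2 : (star d).toCLM ((φ (star a * b)).toCLM (d.toCLM y))
      = R.toCLM ((φ (star a * b)).toCLM y) := by
    have : star d * (φ (star a * b) * d) = R * φ (star a * b) := by
      rw [hdsa, ← (hdcomm _).eq, ← mul_assoc, hdd]
    exact congrArg (fun T : AdjOp C E => T.toCLM y) this
  rw [e1, hs, d.isAdjointPair, e2, ← CStarModule.inner_add_right]
  have e3 : ηs (η ((φ (star a * b)).toCLM y)) + R.toCLM ((φ (star a * b)).toCLM y)
      = (‖S‖ : ℂ) • (φ (star a * b)).toCLM y := by
    have : S + R = (‖S‖ : ℂ) • (1 : AdjOp C E) := by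
      simp only [R, add_sub_cancel]
      rw [Algebra.algebraMap_eq_smul_one, Complex.coe_smul]
    exact congrArg (fun T : AdjOp C E => T.toCLM ((φ (star a * b)).toCLM y)) this
  rw [e3, CStarModule.inner_smul_right_complex, Complex.coe_smul]

/-- The operator `η̃ : A ⊗_φ E → A ⊗_ψ F` with `η̃(a ⊗̇ x) = α(a) ⊗̇ η(x)`. -/
def tildeCLM {φ : A →CP AdjOp C E} {ψ : A →CP AdjOp C F} {η : E →L[ℂ] F}
    (hη : IsAdjointable C η) {α : A ≃⋆ₐ[ℂ] A}
    (h : ∀ a, (ψ (α a)).toCLM ∘L η = η ∘L (φ a).toCLM) : KSModule φ →L[ℂ] KSModule ψ :=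
  SemiInner.liftCLM (tensorMap η α) (tensorMap_bound hη h).choose (tensorMap_bound hη h).choose_spec

theorem tildeCLM_dtmul {φ : A →CP AdjOp C E} {ψ : A →CP AdjOp C F} {η : E →L[ℂ] F}
    (hη : IsAdjointable C η) {α : A ≃⋆ₐ[ℂ] A}
    (h : ∀ a, (ψ (α a)).toCLM ∘L η = η ∘L (φ a).toCLM) (a : A) (x : E) :
    tildeCLM hη h (dtmul φ a x) = dtmul ψ (α a) (η x) :=
  SemiInner.liftCLM_toCompl _ _ _ _

theorem intertwine_adj {φ : A →CP AdjOp C E} {ψ : A →CP AdjOp C F} {η : E →L[ℂ] F}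
    {α : A ≃⋆ₐ[ℂ] A}
    (h : ∀ a, (ψ (α a)).toCLM ∘L η = η ∘L (φ a).toCLM)
    {ηs : F →L[ℂ] E} (hs : IsAdjointPair C η ηs) (a : A) :
    (φ (α.symm a)).toCLM ∘L ηs = ηs ∘L (ψ a).toCLM := by
  have h1 : IsAdjointPair C ((ψ (α (star (α.symm a)))).toCLM ∘L η) (ηs ∘L (ψ a).toCLM) := by
    have := (ψ (star a)).isAdjointPair
    rw [← map_star_cp, star_star] at this
    rw [map_star, StarAlgEquiv.apply_symm_apply]
    exact hs.comp this
  have h2 : IsAdjointPair C (η ∘L (φ (star (α.symm a))).toCLM)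
      ((φ (α.symm a)).toCLM ∘L ηs) := by
    have := (φ (star (α.symm a))).isAdjointPair
    rw [← map_star_cp, star_star] at this
    exact this.comp hs
  rw [h] at h1
  exact h2.unique h1

theorem tildeCLM_adjointable {φ : A →CP AdjOp C E} {ψ : A →CP AdjOp C F} {η : E →L[ℂ] F}
    (hη : IsAdjointable C η) {α : A ≃⋆ₐ[ℂ] A}
    (h : ∀ a, (ψ (α a)).toCLM ∘L η = η ∘L (φ a).toCLM) : IsAdjointable C (tildeCLM hη h) := by
  obtain ⟨ηs, hs⟩ := id hη
  have hηs : IsAdjointable C ηs := ⟨η, hs.symm⟩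
  refine ⟨tildeCLM (α := α.symm) hηs (intertwine_adj h hs), ?_⟩
  refine isAdjointPair_of_dtmul fun a x b y => ?_
  rw [tildeCLM_dtmul, tildeCLM_dtmul, inner_dtmul, inner_dtmul, hs]
  have e : star a * α.symm b = α.symm (star (α a) * b) := by
    rw [map_mul, map_star, StarAlgEquiv.symm_apply_apply]
  rw [e]
  exact congrArg (fun T : F →L[ℂ] E => (inner C x (T y) : C))
    (intertwine_adj h hs (star (α a) * b)).symm

theorem tildeCLM_comm {φ : A →CP AdjOp C E} {ψ : A →CP AdjOp C F} {η : E →L[ℂ] F}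
    (hη : IsAdjointable C η) {α : A ≃⋆ₐ[ℂ] A}
    (h : ∀ a, (ψ (α a)).toCLM ∘L η = η ∘L (φ a).toCLM) (a : A) :
    (piCP ψ (α a)).toCLM ∘L tildeCLM hη h = tildeCLM hη h ∘L (piCP φ a).toCLM :=
  ext_dtmul fun b x => by
    simp only [ContinuousLinearMap.comp_apply, piCP_toCLM, tildeCLM_dtmul, piCLM_dtmul, map_mul]

/-! ### Strict completely positive maps and the operator `V_φ` -/

/-- A completely positive map `φ : A → ℒ(E)` is strict if for some approximate unit of `A`
(consisting of positive contractions) its image under `φ` is Cauchy in the strict topology, that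
is, `φ(a) x` and `φ(a)⋆ x` are Cauchy along the approximate unit for every `x ∈ E`. -/
def IsStrict (φ : A →CP AdjOp C E) : Prop :=
  ∃ l : Filter A, l.IsIncreasingApproximateUnit ∧ ∀ x : E,
    Cauchy (l.map fun a => (φ a).toCLM x) ∧ Cauchy (l.map fun a => (star (φ a)).toCLM x)

theorem exists_dtmul_bound (φ : A →CP AdjOp C E) :
    ∃ M : ℝ, 0 ≤ M ∧ ∀ a x, ‖dtmul φ a x‖ ≤ M * ‖a‖ * ‖x‖ := by
  obtain ⟨M, hM⟩ := PositiveLinearMap.exists_norm_apply_le (PositiveLinearMap.ofClass φ)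
  refine ⟨√M, Real.sqrt_nonneg _, fun a x => ?_⟩
  refine le_of_sq_le_sq ?_ (by positivity)
  rw [CStarModule.norm_sq_eq C, inner_dtmul, mul_pow, mul_pow, Real.sq_sqrt M.coe_nonneg]
  have h1 : ‖φ (star a * a)‖ ≤ M * (‖a‖ * ‖a‖) := by
    have := hM (star a * a)
    rwa [CStarRing.norm_star_mul_self] at this
  calc ‖(inner C x ((φ (star a * a)).toCLM x) : C)‖
      ≤ ‖x‖ * ‖(φ (star a * a)).toCLM x‖ := CStarModule.norm_inner_le E
    _ ≤ ‖x‖ * (‖φ (star a * a)‖ * ‖x‖) := by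
        gcongr; exact (φ (star a * a)).toCLM.le_opNorm x
    _ ≤ ‖x‖ * ((M * (‖a‖ * ‖a‖)) * ‖x‖) := by gcongr
    _ = _ := by ring

theorem continuous_cp (φ : A →CP AdjOp C E) : Continuous φ := map_continuous φ

theorem tendsto_dtmul (φ : A →CP AdjOp C E) {l : Filter A} {f : A → A} {b : A}
    (hf : Tendsto f l (𝓝 b)) (x : E) :
    Tendsto (fun a => dtmul φ (f a) x) l (𝓝 (dtmul φ b x)) := by
  obtain ⟨M, hM0, hM⟩ := exists_dtmul_bound φ
  rw [tendsto_iff_norm_sub_tendsto_zero] at hf ⊢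
  have h2 : Tendsto (fun a => M * ‖f a - b‖ * ‖x‖) l (𝓝 0) := by
    simpa using (hf.const_mul M).mul_const ‖x‖
  refine squeeze_zero (fun _ => norm_nonneg _) (fun a => ?_) h2
  rw [← dtmul_sub_left]
  exact hM _ _

theorem norm_piCLM_le (φ : A →CP AdjOp C E) (a : A) : ‖piCLM φ a‖ ≤ ‖a‖ :=
  NonUnitalStarAlgHom.norm_apply_le (piHom φ) a

theorem tendsto_piCLM (φ : A →CP AdjOp C E) {l : Filter A} (hl : l.IsIncreasingApproximateUnit)
    (z : KSModule φ) : Tendsto (fun a => piCLM φ a z) l (𝓝 z) := by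
  have hpre : ∀ w : A ⊗[ℂ] E, Tendsto (fun a => piCLM φ a ((ksSemiInner φ).toCompl w)) l
      (𝓝 ((ksSemiInner φ).toCompl w)) := fun w => by
    induction w using TensorProduct.induction_on with
    | zero => simpa [SemiInner.toCompl_zero] using tendsto_const_nhds
    | tmul b x =>
      change Tendsto (fun a => piCLM φ a (dtmul φ b x)) l (𝓝 (dtmul φ b x))
      simp only [piCLM_dtmul]
      exact tendsto_dtmul φ (hl.tendsto_mul_right b) x
    | add w w' h h' =>
      simp only [SemiInner.toCompl_add, map_add]
      exact h.add h'
  rw [Metric.tendsto_nhds]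
  intro ε hε
  obtain ⟨w, hw⟩ := (ksSemiInner φ).denseRange_toCompl.exists_dist_lt z (ε := ε / 3) (by positivity)
  filter_upwards [hl.eventually_norm, Metric.tendsto_nhds.mp (hpre w) (ε / 3) (by positivity)]
    with a ha haw
  set y := (ksSemiInner φ).toCompl w
  have h1 : dist (piCLM φ a z) (piCLM φ a y) ≤ dist z y := by
    rw [dist_eq_norm, dist_eq_norm, ← map_sub]
    refine ((piCLM φ a).le_opNorm _).trans ?_
    exact mul_le_of_le_one_left (norm_nonneg _) ((norm_piCLM_le φ a).trans ha)
  calc dist (piCLM φ a z) z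
      ≤ dist (piCLM φ a z) (piCLM φ a y) + dist (piCLM φ a y) y + dist y z := dist_triangle4 _ _ _ _
    _ < ε := by rw [dist_comm y z]; linarith

/-- `π_φ` is strict (indeed non-degenerate). -/
theorem piCP_isStrict (φ : A →CP AdjOp C E) : IsStrict (piCP φ) := by
  have hl := CStarAlgebra.increasingApproximateUnit A
  have := hl.neBot
  refine ⟨_, hl, fun z => ⟨?_, ?_⟩⟩
  · exact (tendsto_piCLM φ hl z).cauchy_map
  · refine Tendsto.cauchy_map ((tendsto_piCLM φ hl z).congr' ?_)
    filter_upwards [hl.eventually_star_eq] with a ha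
    rw [← map_star_cp, ha, piCP_toCLM]

theorem mul_self_le {a : A} (h0 : 0 ≤ a) (h1 : ‖a‖ ≤ 1) : a * a ≤ a := by
  obtain ⟨b, hb⟩ := CStarAlgebra.nonneg_iff_eq_star_mul_self.mp h0
  calc a * a = star b * (b * star b) * b := by rw [hb]; simp only [mul_assoc]
    _ ≤ ‖b * star b‖ • (star b * b) :=
      CStarAlgebra.star_left_conjugate_le_norm_smul (hb := .mul_star_self b)
    _ = ‖a‖ • a := by rw [CStarRing.norm_self_mul_star, ← CStarRing.norm_star_mul_self, ← hb]
    _ ≤ a := by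
      have : 0 ≤ (1 - ‖a‖) • a := smul_nonneg (sub_nonneg.mpr h1) h0
      rw [sub_smul, one_smul] at this
      exact sub_nonneg.mp this

theorem dtmul_sq_le (φ : A →CP AdjOp C E) {a b : A} (ha : 0 ≤ a) (ha1 : ‖a‖ ≤ 1) (hb : 0 ≤ b)
    (hb1 : ‖b‖ ≤ 1) (x : E) : ‖dtmul φ a x - dtmul φ b x‖ ^ 2
      ≤ ‖x‖ * ‖(φ a).toCLM x + (φ b).toCLM x - (φ (a * b)).toCLM x - (φ (b * a)).toCLM x‖ := by
  rw [← dtmul_sub_left, CStarModule.norm_sq_eq C, inner_dtmul]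
  have hsa : star (a - b) = a - b := by
    rw [star_sub, (IsSelfAdjoint.of_nonneg ha).star_eq, (IsSelfAdjoint.of_nonneg hb).star_eq]
  have hle : star (a - b) * (a - b) ≤ a + b - a * b - b * a := by
    rw [hsa, mul_sub, sub_mul, sub_mul]
    calc a * a - b * a - (a * b - b * b) = (a * a + b * b) - a * b - b * a := by abel
      _ ≤ _ := by gcongr <;> exact mul_self_le ‹_› ‹_›
  have hmono : ∀ c : A, 0 ≤ c → (0 : C) ≤ inner C x ((φ c).toCLM x) := fun c hc => by
    obtain ⟨e, rfl⟩ := CStarAlgebra.nonneg_iff_eq_star_mul_self.mp hc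
    rw [← inner_dtmul]
    exact CStarModule.inner_self_nonneg
  have h0 := hmono _ (star_mul_self_nonneg (a - b))
  have h1 := hmono _ (sub_nonneg.mpr hle)
  rw [map_sub, AdjOp.toCLM_sub, sub_apply, CStarModule.inner_sub_right,
    sub_nonneg] at h1
  refine (CStarAlgebra.norm_le_norm_of_nonneg_of_le h0 h1).trans ?_
  refine (CStarModule.norm_inner_le E).trans_eq ?_
  simp only [map_sub, map_add, AdjOp.toCLM_sub, AdjOp.toCLM_add, sub_apply, add_apply]

theorem cauchy_dtmul (φ : A →CP AdjOp C E) {l : Filter A} (hl : l.IsIncreasingApproximateUnit)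
    {x : E} (hc : Cauchy (l.map fun a => (φ a).toCLM x)) :
    Cauchy (l.map fun a => dtmul φ a x) := by
  have := hl.neBot
  obtain ⟨t, ht⟩ := CompleteSpace.complete hc
  have ht : Tendsto (fun a => (φ a).toCLM x) l (𝓝 t) := ht
  have happly : ∀ {f : A → A} {b : A}, Tendsto f l (𝓝 b) →
      Tendsto (fun a => (φ (f a)).toCLM x) l (𝓝 ((φ b).toCLM x)) := fun {f b} hf => by
    have h1 : Tendsto (fun a => φ (f a)) l (𝓝 (φ b)) := ((continuous_cp φ).tendsto b).comp hf
    have h2 : Continuous fun T : AdjOp C E => T.toCLM x :=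
      (ContinuousLinearMap.apply ℂ E x).continuous.comp continuous_subtype_val
    exact (h2.tendsto _).comp h1
  rw [Metric.cauchy_iff]
  refine ⟨inferInstance, fun ε hε => ?_⟩
  have h1 : Tendsto (fun b => ‖x‖ * ‖t - (φ b).toCLM x‖) l (𝓝 0) := by
    have := (ht.const_sub t).norm.const_mul ‖x‖
    simpa using this
  have hε2 : 0 < (ε / 2) ^ 2 := by positivity
  obtain ⟨b, hb, hb0, hb1⟩ := ((h1.eventually_lt_const hε2).and
    (hl.eventually_nonneg.and hl.eventually_norm)).exists
  have h2 : Tendsto (fun a => ‖x‖ * ‖(φ a).toCLM x + (φ b).toCLM x - (φ (a * b)).toCLM x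
      - (φ (b * a)).toCLM x‖) l (𝓝 (‖x‖ * ‖t - (φ b).toCLM x‖)) := by
    have := ((((ht.add_const ((φ b).toCLM x)).sub (happly (hl.tendsto_mul_right b))).sub
      (happly (hl.tendsto_mul_left b))).norm).const_mul ‖x‖
    simpa using this
  refine ⟨Metric.ball (dtmul φ b x) (ε / 2), ?_, fun y hy z hz => ?_⟩
  · rw [mem_map]
    filter_upwards [h2.eventually_lt_const hb, hl.eventually_nonneg, hl.eventually_norm]
      with a ha ha0 ha1
    rw [Set.mem_preimage, Metric.mem_ball, dist_eq_norm]
    exact lt_of_pow_lt_pow_left₀ 2 (by positivity) ((dtmul_sq_le φ ha0 ha1 hb0 hb1 x).trans_lt ha)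
  · calc dist y z ≤ dist y (dtmul φ b x) + dist z (dtmul φ b x) := dist_triangle_right _ _ _
      _ < ε := by
        have := Metric.mem_ball.mp hy
        have := Metric.mem_ball.mp hz
        linarith

theorem exists_ksV (φ : A →CP AdjOp C E) (hφ : IsStrict φ) (x : E) :
    ∃ z, Tendsto (fun a => dtmul φ a x) hφ.choose (𝓝 z) :=
  CompleteSpace.complete (cauchy_dtmul φ hφ.choose_spec.1 (hφ.choose_spec.2 x).1)

/-- The linear map `V_φ`, `V_φ x = lim a_λ ⊗̇ x` for an approximate unit `(a_λ)` of `A` whose image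
under `φ` is strictly Cauchy. -/
def ksVLin (φ : A →CP AdjOp C E) (hφ : IsStrict φ) : E →ₗ[ℂ] KSModule φ where
  toFun x := (exists_ksV φ hφ x).choose
  map_add' x y := by
    have := hφ.choose_spec.1.neBot
    refine tendsto_nhds_unique (exists_ksV φ hφ (x + y)).choose_spec ?_
    simp only [dtmul_add_right]
    exact (exists_ksV φ hφ x).choose_spec.add (exists_ksV φ hφ y).choose_spec
  map_smul' r x := by
    have := hφ.choose_spec.1.neBot
    refine tendsto_nhds_unique (exists_ksV φ hφ (r • x)).choose_spec ?_
    simp only [dtmul_smul_right]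
    exact (exists_ksV φ hφ x).choose_spec.const_smul r

theorem ksVLin_bound (φ : A →CP AdjOp C E) (hφ : IsStrict φ) :
    ∃ M : ℝ, ∀ x, ‖ksVLin φ hφ x‖ ≤ M * ‖x‖ := by
  obtain ⟨M, hM0, hM⟩ := exists_dtmul_bound φ
  have := hφ.choose_spec.1.neBot
  refine ⟨M, fun x => le_of_tendsto (exists_ksV φ hφ x).choose_spec.norm ?_⟩
  filter_upwards [hφ.choose_spec.1.eventually_norm] with a ha
  refine (hM a x).trans ?_
  gcongr
  exact mul_le_of_le_one_right hM0 ha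

/-- The operator `V_φ : E → A ⊗_φ E` of the KSGNS construction. -/
def ksV (φ : A →CP AdjOp C E) (hφ : IsStrict φ) : E →L[ℂ] KSModule φ :=
  (ksVLin φ hφ).mkContinuousOfExistsBound (ksVLin_bound φ hφ)

/-- `V_φ x` is the limit of `a ⊗̇ x` along the approximate unit witnessing strictness. -/
theorem tendsto_ksV (φ : A →CP AdjOp C E) (hφ : IsStrict φ) (x : E) :
    Tendsto (fun a => dtmul φ a x) hφ.choose (𝓝 (ksV φ hφ x)) :=
  (exists_ksV φ hφ x).choose_spec

end KSGNS

/-! ### The category `PosCor(A, B)` and the functor `KSGNS` -/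

section Category

/-- A positive correspondence from `A` to `B`: a (right) Hilbert `B`-module `E`, that is a Hilbert
module over `Bᵐᵒᵖ` in the convention `⟨x, c y⟩ = c ⟨x, y⟩` of `CStarModule` (the module laws follow
from those of the inner product), with a strict completely positive map `φ : A → ℒ(E)`. -/
structure PosCor (A : Type u) (B : Type v)
    [NonUnitalCStarAlgebra A] [PartialOrder A] [StarOrderedRing A]
    [NonUnitalCStarAlgebra B] [PartialOrder B] [StarOrderedRing B] where
  E : Type w
  [normedAddCommGroup : NormedAddCommGroup E]
  [normedSpace : NormedSpace ℂ E]
  [smul : SMul Bᵐᵒᵖ E]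
  [cstarModule : CStarModule Bᵐᵒᵖ E]
  [completeSpace : CompleteSpace E]
  φ : A →CP AdjOp Bᵐᵒᵖ E
  strict : IsStrict φ

attribute [instance] PosCor.normedAddCommGroup PosCor.normedSpace PosCor.smul PosCor.cstarModule
  PosCor.completeSpace

variable {A : Type u} {B : Type v}
  [NonUnitalCStarAlgebra A] [PartialOrder A] [StarOrderedRing A]
  [NonUnitalCStarAlgebra B] [PartialOrder B] [StarOrderedRing B]

namespace PosCor

/-- A morphism `(η, α)` of positive correspondences: `η ∈ ℒ(E₁, E₂)` and a ⋆-automorphism `α` of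
`A` with `φ₂(α(a)) ∘ η = η ∘ φ₁(a)` for all `a`. -/
@[ext] structure Hom (X Y : PosCor.{u, v, w} A B) where
  η : X.E →L[ℂ] Y.E
  α : A ≃⋆ₐ[ℂ] A
  adjointable : IsAdjointable Bᵐᵒᵖ η
  comm : ∀ a, (Y.φ (α a)).toCLM ∘L η = η ∘L (X.φ a).toCLM

instance : Category (PosCor.{u, v, w} A B) where
  Hom := Hom
  id X :=
    { η := .id ℂ X.E
      α := .refl ℂ A
      adjointable := ⟨_, .id⟩
      comm := fun _ => rfl }
  comp {X Y Z} f g :=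
    { η := g.η ∘L f.η
      α := f.α.trans g.α
      adjointable := by
        obtain ⟨S, hS⟩ := f.adjointable
        obtain ⟨T, hT⟩ := g.adjointable
        exact ⟨_, hS.comp hT⟩
      comm := fun a => by
        rw [StarAlgEquiv.trans_apply, ← ContinuousLinearMap.comp_assoc, g.comm,
          ContinuousLinearMap.comp_assoc, f.comm, ContinuousLinearMap.comp_assoc] }
  id_comp _ := rfl
  comp_id _ := rfl
  assoc _ _ _ := rfl

@[ext] theorem hom_ext {X Y : PosCor.{u, v, w} A B} {f g : X ⟶ Y} (h : f.η = g.η)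
    (h' : f.α = g.α) : f = g := Hom.ext h h'

@[simp] theorem id_η (X : PosCor.{u, v, w} A B) : Hom.η (𝟙 X) = .id ℂ X.E := rfl
@[simp] theorem id_α (X : PosCor.{u, v, w} A B) : Hom.α (𝟙 X) = .refl ℂ A := rfl
@[simp] theorem comp_η {X Y Z : PosCor.{u, v, w} A B} (f : X ⟶ Y) (g : Y ⟶ Z) :
    Hom.η (f ≫ g) = g.η ∘L f.η := rfl
@[simp] theorem comp_α {X Y Z : PosCor.{u, v, w} A B} (f : X ⟶ Y) (g : Y ⟶ Z) :
    Hom.α (f ≫ g) = f.α.trans g.α := rfl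

/-- The positive correspondence `(A ⊗_φ E, π_φ)`. -/
def ks (X : PosCor.{u, v, max u w} A B) : PosCor.{u, v, max u w} A B where
  E := KSModule X.φ
  φ := piCP X.φ
  strict := piCP_isStrict X.φ

end PosCor

/-- The functor `KSGNS`, sending `(E, φ)` to `(A ⊗_φ E, π_φ)` and `(η, α)` to `(η̃, α)` with
`η̃(a ⊗̇ x) = α(a) ⊗̇ η(x)`. -/
def KSGNS (A : Type u) (B : Type v)
    [NonUnitalCStarAlgebra A] [PartialOrder A] [StarOrderedRing A]
    [NonUnitalCStarAlgebra B] [PartialOrder B] [StarOrderedRing B] :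
    PosCor.{u, v, max u w} A B ⥤ PosCor.{u, v, max u w} A B where
  obj X := PosCor.ks.{u, v, w} X
  map f :=
    { η := tildeCLM f.adjointable f.comm
      α := f.α
      adjointable := tildeCLM_adjointable f.adjointable f.comm
      comm := tildeCLM_comm f.adjointable f.comm }
  map_id X := PosCor.hom_ext (ext_dtmul fun a x => tildeCLM_dtmul
    (PosCor.Hom.adjointable (𝟙 X)) (PosCor.Hom.comm (𝟙 X)) a x) rfl
  map_comp f g := PosCor.hom_ext (ext_dtmul fun a x =>
    (tildeCLM_dtmul (f ≫ g).adjointable (f ≫ g).comm a x).trans (((congrArg _ (tildeCLM_dtmul f.adjointable f.comm a x)).trans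
      (tildeCLM_dtmul g.adjointable g.comm (f.α a) (f.η x))).symm)) rfl

end Category

end HilbertModule

end

/-!
Write `V = V_{π_φ}`. Since `π_φ` is multiplicative, the balancing relation
`a ⊗̇ π_φ(b) z = ab ⊗̇ z` holds in `A ⊗_{π_φ} (A ⊗_φ E)` (`dtmul_piCLM`); letting `a` run through
the approximate unit that defines `V` gives `V (π_φ(b) z) = b ⊗̇ z` (`ksV_piCLM`). Everything
follows from this formula. The range of `V` contains all simple tensors. As `π_φ` is
non-degenerate, `V` preserves inner products (`inner_ksV_ksV`), so it is a surjective isometry,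
and its inverse is an adjoint. Again by non-degeneracy, continuous maps on `A ⊗_φ E` that agree on
all vectors `π_φ(b) z` are equal (`ext_piCLM`), and on such vectors both the intertwining relation
`π_{π_φ}(a) V = V π_φ(a)` and naturality are read off from the formula.
-/

namespace HilbertModule

section KSGNS

variable {A : Type u} [NonUnitalCStarAlgebra A] [PartialOrder A] [StarOrderedRing A]
variable {C : Type v} [NonUnitalCStarAlgebra C] [PartialOrder C] [StarOrderedRing C]
variable {E : Type w₁} [NormedAddCommGroup E] [NormedSpace ℂ E] [SMul C E] [CStarModule C E]
  [CompleteSpace E]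
variable {F : Type w₂} [NormedAddCommGroup F] [NormedSpace ℂ F] [SMul C F] [CStarModule C F]
  [CompleteSpace F]

/-- A continuous linear map on `A ⊗_φ E` is determined by its values on the vectors `π_φ(b) z`,
because `π_φ` is non-degenerate. -/
theorem ext_piCLM {φ : A →CP AdjOp C E} {G : Type w₃} [NormedAddCommGroup G] [NormedSpace ℂ G]
    {S T : KSModule φ →L[ℂ] G} (h : ∀ b z, S (piCLM φ b z) = T (piCLM φ b z)) : S = T := by
  have hl := CStarAlgebra.increasingApproximateUnit A
  have := hl.neBot
  ext z
  have hz := tendsto_piCLM φ hl z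
  exact tendsto_nhds_unique (((S.continuous.tendsto z).comp hz).congr fun b => h b z)
    ((T.continuous.tendsto z).comp hz)

theorem piCLM_mul_apply (φ : A →CP AdjOp C E) (a b : A) (z : KSModule φ) :
    piCLM φ (a * b) z = piCLM φ a (piCLM φ b z) :=
  congrArg (fun T : AdjOp C (KSModule φ) => T.toCLM z) (map_mul (piHom φ) a b)

/-- The second tensor product is balanced over `π_φ`. -/
theorem dtmul_piCLM (φ : A →CP AdjOp C E) (a b : A) (z : KSModule φ) :
    dtmul (piCP φ) a (piCLM φ b z) = dtmul (piCP φ) (a * b) z := by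
  -- The difference is orthogonal to all simple tensors, in particular to itself.
  have key : ∀ c w, (inner C (dtmul (piCP φ) c w)
      (dtmul (piCP φ) a (piCLM φ b z) - dtmul (piCP φ) (a * b) z) : C) = 0 := fun c w => by
    rw [CStarModule.inner_sub_right, inner_dtmul, inner_dtmul, piCP_toCLM, piCP_toCLM,
      ← piCLM_mul_apply, mul_assoc, sub_self]
  refine sub_eq_zero.mp (CStarModule.inner_self (A := C).mp ?_)
  rw [CStarModule.inner_sub_left, key, key, sub_self]

theorem ksV_piCLM (φ : A →CP AdjOp C E) (h : IsStrict (piCP φ)) (b : A) (z : KSModule φ) :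
    ksV (piCP φ) h (piCLM φ b z) = dtmul (piCP φ) b z := by
  have := h.choose_spec.1.neBot
  refine tendsto_nhds_unique (tendsto_ksV (piCP φ) h _) ?_
  simp only [dtmul_piCLM]
  exact tendsto_dtmul (piCP φ) (h.choose_spec.1.tendsto_mul_right b) z

/-- The adjoint of `V_{π_φ}` sends `b ⊗̇ w` to `π_φ(b) w`. -/
theorem inner_ksV_dtmul (φ : A →CP AdjOp C E) (h : IsStrict (piCP φ)) (z : KSModule φ) (b : A)
    (w : KSModule φ) :
    (inner C (ksV (piCP φ) h z) (dtmul (piCP φ) b w) : C) = inner C z (piCLM φ b w) := by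
  have hl := h.choose_spec.1
  have := hl.neBot
  have h1 := ((CStarModule.continuous_inner (A := C) (E := KSModule (piCP φ))).tendsto _).comp
    ((tendsto_ksV (piCP φ) h z).prodMk_nhds (tendsto_const_nhds (x := dtmul (piCP φ) b w)))
  have h2 := ((CStarModule.continuous_inner (A := C) (E := KSModule φ)).tendsto _).comp
    ((tendsto_const_nhds (x := z)).prodMk_nhds (tendsto_piCLM φ hl (piCLM φ b w)))
  refine tendsto_nhds_unique (h1.congr' ?_) h2
  filter_upwards [hl.eventually_star_eq] with a ha
  simp only [Function.comp_apply]
  rw [inner_dtmul, ha, piCP_toCLM, piCLM_mul_apply]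

theorem inner_ksV_ksV (φ : A →CP AdjOp C E) (h : IsStrict (piCP φ)) (z w : KSModule φ) :
    (inner C (ksV (piCP φ) h z) (ksV (piCP φ) h w) : C) = inner C z w := by
  have hl := h.choose_spec.1
  have := hl.neBot
  have h1 := ((CStarModule.continuous_inner (A := C) (E := KSModule (piCP φ))).tendsto _).comp
    ((tendsto_const_nhds (x := ksV (piCP φ) h z)).prodMk_nhds (tendsto_ksV (piCP φ) h w))
  have h2 := ((CStarModule.continuous_inner (A := C) (E := KSModule φ)).tendsto _).comp
    ((tendsto_const_nhds (x := z)).prodMk_nhds (tendsto_piCLM φ hl w))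
  exact tendsto_nhds_unique (h1.congr fun a => inner_ksV_dtmul φ h z a w) h2

theorem norm_ksV (φ : A →CP AdjOp C E) (h : IsStrict (piCP φ)) (z : KSModule φ) :
    ‖ksV (piCP φ) h z‖ = ‖z‖ := by
  rw [CStarModule.norm_eq_sqrt_norm_inner_self (A := C), inner_ksV_ksV,
    ← CStarModule.norm_eq_sqrt_norm_inner_self (A := C)]

theorem ksV_surjective (φ : A →CP AdjOp C E) (h : IsStrict (piCP φ)) :
    Function.Surjective (ksV (piCP φ) h) := by
  have hiso : Isometry (ksV (piCP φ) h) :=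
    AddMonoidHomClass.isometry_of_norm _ (norm_ksV φ h)
  -- The range is closed, since `V` is isometric, and contains the dense algebraic tensor product.
  have hsub : ∀ t : A ⊗[ℂ] KSModule φ,
      (ksSemiInner (piCP φ)).toCompl t ∈ Set.range (ksV (piCP φ) h) := fun t => by
    induction t using TensorProduct.induction_on with
    | zero => exact ⟨0, by rw [map_zero, SemiInner.toCompl_zero]⟩
    | tmul b z => exact ⟨piCLM φ b z, ksV_piCLM φ h b z⟩
    | add s t hs ht =>
      obtain ⟨y, hy⟩ := hs
      obtain ⟨z, hz⟩ := ht
      exact ⟨y + z, by rw [map_add, hy, hz, SemiInner.toCompl_add]⟩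
  intro y
  exact hiso.isClosedEmbedding.isClosed_range.closure_subset_iff.mpr
    (Set.range_subset_iff.mpr hsub) ((ksSemiInner (piCP φ)).denseRange_toCompl y)

/-- `V_{π_φ}` is unitary. -/
theorem exists_adjoint_inverse_ksV (φ : A →CP AdjOp C E) (h : IsStrict (piCP φ)) :
    ∃ W : KSModule (piCP φ) →L[ℂ] KSModule φ, IsAdjointPair C (ksV (piCP φ) h) W ∧
      W ∘L ksV (piCP φ) h = .id ℂ _ ∧ ksV (piCP φ) h ∘L W = .id ℂ _ := by
  let e : KSModule φ ≃ₗᵢ[ℂ] KSModule (piCP φ) :=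
    .ofSurjective ⟨(ksV (piCP φ) h).toLinearMap, norm_ksV φ h⟩ (ksV_surjective φ h)
  have he : ∀ y, ksV (piCP φ) h (e.symm y) = y := e.apply_symm_apply
  refine ⟨e.symm.toContinuousLinearEquiv.toContinuousLinearMap, fun x y => ?_,
    ContinuousLinearMap.ext fun x => e.symm_apply_apply x, ContinuousLinearMap.ext he⟩
  exact (congrArg _ (he y).symm).trans (inner_ksV_ksV φ h x (e.symm y))

theorem piCP_piCP_comp_ksV (φ : A →CP AdjOp C E) (h : IsStrict (piCP φ)) (a : A) :
    (piCP (piCP φ) a).toCLM ∘L ksV (piCP φ) h = ksV (piCP φ) h ∘L (piCP φ a).toCLM :=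
  ext_piCLM fun b z => by
    simp only [ContinuousLinearMap.comp_apply, piCP_toCLM]
    rw [ksV_piCLM, piCLM_dtmul, ← piCLM_mul_apply, ksV_piCLM]

theorem ksV_comp_tildeCLM {φ : A →CP AdjOp C E} {ψ : A →CP AdjOp C F} (hφ : IsStrict (piCP φ))
    (hψ : IsStrict (piCP ψ)) {η : E →L[ℂ] F} (hη : IsAdjointable C η) {α : A ≃⋆ₐ[ℂ] A}
    (h : ∀ a, (ψ (α a)).toCLM ∘L η = η ∘L (φ a).toCLM) :
    ksV (piCP ψ) hψ ∘L tildeCLM hη h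
      = tildeCLM (tildeCLM_adjointable hη h) (tildeCLM_comm hη h) ∘L ksV (piCP φ) hφ :=
  ext_piCLM fun b z => by
    have hb : tildeCLM hη h (piCLM φ b z) = piCLM ψ (α b) (tildeCLM hη h z) :=
      (congrArg (fun T => T z) (tildeCLM_comm hη h b)).symm
    rw [ContinuousLinearMap.comp_apply, ContinuousLinearMap.comp_apply, hb, ksV_piCLM, ksV_piCLM,
      tildeCLM_dtmul]

end KSGNS

section Category

variable {A : Type u} {B : Type v}
  [NonUnitalCStarAlgebra A] [PartialOrder A] [StarOrderedRing A]
  [NonUnitalCStarAlgebra B] [PartialOrder B] [StarOrderedRing B]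

/-- A unitary `V` with adjoint `W` that intertwines the two completely positive maps, as an
isomorphism `(V, 1_A)` of positive correspondences. -/
def PosCor.isoOfUnitary {X Y : PosCor.{u, v, w} A B} (V : X.E →L[ℂ] Y.E) (W : Y.E →L[ℂ] X.E)
    (hVW : IsAdjointPair Bᵐᵒᵖ V W) (hWV : W ∘L V = .id ℂ _) (hVW' : V ∘L W = .id ℂ _)
    (hV : ∀ a, (Y.φ a).toCLM ∘L V = V ∘L (X.φ a).toCLM) : X ≅ Y where
  hom :=
    { η := V
      α := .refl ℂ A
      adjointable := ⟨W, hVW⟩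
      comm := hV }
  inv :=
    { η := W
      α := .refl ℂ A
      adjointable := ⟨V, hVW.symm⟩
      comm := intertwine_adj (α := .refl ℂ A) hV hVW }
  hom_inv_id := PosCor.hom_ext hWV rfl
  inv_hom_id := PosCor.hom_ext hVW' rfl

/-- The component `(V_{π_φ}, 1_A)` of the natural isomorphism. -/
noncomputable def ksVIso (X : PosCor.{u, v, max u w} A B) :
    PosCor.ks.{u, v, w} X ≅ PosCor.ks.{u, v, w} (PosCor.ks.{u, v, w} X) :=
  PosCor.isoOfUnitary (ksV (piCP X.φ) (piCP_isStrict X.φ))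
    (exists_adjoint_inverse_ksV X.φ (piCP_isStrict X.φ)).choose
    (exists_adjoint_inverse_ksV X.φ (piCP_isStrict X.φ)).choose_spec.1
    (exists_adjoint_inverse_ksV X.φ (piCP_isStrict X.φ)).choose_spec.2.1
    (exists_adjoint_inverse_ksV X.φ (piCP_isStrict X.φ)).choose_spec.2.2
    (piCP_piCP_comp_ksV X.φ (piCP_isStrict X.φ))

end Category

end HilbertModule

open HilbertModule in
theorem mainTheorem2 (A : Type u) (B : Type v)
    [NonUnitalCStarAlgebra A] [PartialOrder A] [StarOrderedRing A]
    [NonUnitalCStarAlgebra B] [PartialOrder B] [StarOrderedRing B] :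
    ∃ i : KSGNS.{u, v, w} A B ≅ KSGNS.{u, v, w} A B ⋙ KSGNS.{u, v, w} A B,
      ∀ X : PosCor.{u, v, max u w} A B,
        -- the component at `X = (E, φ)` is `(V_{π_φ}, 1_A)`
        (i.hom.app X).η = ksV (piCP X.φ) (piCP_isStrict X.φ) ∧
        (i.hom.app X).α = StarAlgEquiv.refl ℂ A ∧
        -- `V = V_{π_φ}` is unitary (with `W` its adjoint) and `π_{π_φ}(a) = V π_φ(a) V⋆`
        ∃ W : KSModule (piCP X.φ) →L[ℂ] KSModule X.φ,
          IsAdjointPair Bᵐᵒᵖ (ksV (piCP X.φ) (piCP_isStrict X.φ)) W ∧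
          W ∘L ksV (piCP X.φ) (piCP_isStrict X.φ) = .id ℂ _ ∧
          ksV (piCP X.φ) (piCP_isStrict X.φ) ∘L W = .id ℂ _ ∧
          ∀ a, (piCP (piCP X.φ) a).toCLM
            = ksV (piCP X.φ) (piCP_isStrict X.φ) ∘L (piCP X.φ a).toCLM ∘L W := by
  refine ⟨NatIso.ofComponents (fun X => ksVIso.{u, v, w} X) fun {X Y} f => PosCor.hom_ext
    (ksV_comp_tildeCLM (piCP_isStrict X.φ) (piCP_isStrict Y.φ) f.adjointable f.comm) rfl,
    fun X => ⟨rfl, rfl, ?_⟩⟩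
  obtain ⟨W, hW, hWV, hVW⟩ := exists_adjoint_inverse_ksV X.φ (piCP_isStrict X.φ)
  refine ⟨W, hW, hWV, hVW, fun a => ?_⟩
  rw [← ContinuousLinearMap.comp_assoc, ← piCP_piCP_comp_ksV, ContinuousLinearMap.comp_assoc, hVW,
    ContinuousLinearMap.comp_id]
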